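/- Let $\Gamma$ be a finitely generated group with finite generating set $S_\Gamma$, and for $1\le p\le\infty$ let \[ j_{p,\Gamma}(n)=\sup\Bigl\{\frac{\|f\|_p}{\|\nabla_{S_\Gamma} f\|_p} : f\colon\Gamma\to\mathbb R,\ f\ne 0,\ |\operatorname{supp} f|\le n\Bigr\}\in[0,\infty] \] be its $\ell^p$-isoperimetric profile, where $\nabla_{S_\Gamma}f(s,g)=f(sg)-f(g)$ for $(s,g)\in S_\Gamma\times\Gamma$, the norms are the $\ell^p$ norms on $\Gamma$ and on $S_\Gamma\times\Gamma$, a quotient with denominator $0$ is $+\infty$ (this occurs only if $\Gamma$ is finite), and the supremum over the empty set is $0$. For non-decreasing $u,v\colon\mathbb N\to[0,\infty]$ write $v\succcurlyeq u$ if there is a positive integer $C$ such that $u(n)=O(v(Cn))$ as $n\to\infty$. A map $\varphi\colon\Gamma\to\Lambda$ between finitely generated groups is called regular if it is Lipschitz for the word metrics and there is $m\in\mathbb N$ such that $|\varphi^{-1}(y)|\le m$ for all $y\in\Lambda$. Let $\Gamma$ and $\Lambda$ be finitely generated amenable groups, with finite generating sets $S_\Gamma$ and $S_\Lambda$, such that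 there exists a regular map $\Gamma\to\Lambda$. Then for every $1\le p\le\infty$ \[ j_{p,\Gamma}\succcurlyeq j_{p,\Lambda}. \] -/

import Mathlib

open scoped ENNReal NNReal Pointwise symmDiff

noncomputable section

/-- A finite subset that generates the group. -/
def IsGenerating {G : Type*} [Group G] (S : Finset G) : Prop :=
  Subgroup.closure (S : Set G) = ⊤

/-- The (left-invariant) word metric of `S`, i.e. the path metric of the Cayley graph in which `g`
is adjacent to `g * s` for `s ∈ S`. -/
def wordDist {G : Type*} [Group G] (S : Finset G) (g h : G) : ℕ∞ :=
  (SimpleGraph.mulCayley (S : Set G)).edist g h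

/-- Amenability of a discrete group (Følner's condition): there are non-empty finite sets that are
almost invariant under any prescribed finite set of left translations. -/
def IsAmenable (G : Type*) [Group G] : Prop :=
  ∀ (K : Finset G) (ε : ℝ), 0 < ε → ∃ F : Finset G, F.Nonempty ∧
    ∀ g ∈ K, (((g • (F : Set G)) ∆ (F : Set G)).ncard : ℝ) ≤ ε * F.card

/-- A regular map: Lipschitz for the word metrics, with fibres of uniformly bounded size. -/
structure IsRegularMap {G H : Type*} [Group G] [Group H] (S : Finset G) (T : Finset H)
    (φ : G → H) : Prop where
  lipschitz : ∃ L : ℕ, ∀ a b : G, wordDist T (φ a) (φ b) ≤ (L : ℕ∞) * wordDist S a b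
  fibres : ∃ m : ℕ, ∀ y : H, (φ ⁻¹' {y}).encard ≤ m

/-- The `ℓ^p` norm of a function on a set, `0 < p ≤ ∞`, with values in `[0, ∞]`: the `L^p` norm for
the counting measure on all subsets. -/
def ellNorm {ι : Type*} (p : ℝ≥0∞) (f : ι → ℝ) : ℝ≥0∞ :=
  letI : MeasurableSpace ι := ⊤
  MeasureTheory.eLpNorm f p MeasureTheory.Measure.count

/-- The left gradient `(s, g) ↦ f (s g) - f g` on `S × G`. -/
def leftGradient {G : Type*} [Group G] (S : Finset G) (f : G → ℝ) : S × G → ℝ :=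
  fun x => f ((x.1 : G) * x.2) - f x.2

/-- The `ℓ^p`-isoperimetric profile: the supremum of `‖f‖_p / ‖∇ f‖_p` over the functions whose
support has at most `n` elements. In `[0, ∞]` one has `0 / 0 = 0`, so `f = 0` does not contribute,
and `a / 0 = ∞` for `a ≠ 0`, which happens only for a finite group and `n` at least its order. -/
def isoProfile {G : Type*} [Group G] (p : ℝ≥0∞) (S : Finset G) (n : ℕ) : ℝ≥0∞ :=
  ⨆ (f : G → ℝ) (_ : (Function.support f).encard ≤ n), ellNorm p f / ellNorm p (leftGradient S f)

/-- Asymptotic domination `u ≼ v` of non-decreasing functions: `u n = O (v (C n))` as `n → ∞`, for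
some positive constant `C`. -/
def AsympLE (u v : ℕ → ℝ≥0∞) : Prop :=
  ∃ C : ℕ, 0 < C ∧ ∃ M : ℝ≥0, ∀ᶠ n in Filter.atTop, u n ≤ (M : ℝ≥0∞) * v (C * n)

end

/-! ### Norms for the counting measure -/

section EllNorm

variable {ι κ : Type*} {p : ℝ≥0∞}

/-! Given `f` on `H` with at most `n` support points, and `y : H`, put `u_y g = f ((φ g⁻¹)⁻¹ * y)`
on `G`. The inversions turn left multiplication by `s`, which the gradient sees, into an edge of the
left-invariant Cayley graph, where `φ` is Lipschitz. Bounded fibres give `u_y` at most `m * n`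
support points.

For finite `p`, cut `u_y` off outside a Følner set `F` and sum over all `y`. The `p`-th powers of
the norms add up to `|F| ‖f‖^p` (`tsum_enorm_truncatedPullback`), those of the gradients to at most
a constant times `|F| ‖∇f‖^p` (`tsum_gradient_truncatedPullback_le`). Summing the isoperimetric
inequality of `G` over `y` and cancelling `|F|` gives that of `H`. For `p = ∞` a single `u_y`
suffices, without cut-off. -/

lemma ellNorm_rpow (hp : p ≠ 0) (hp' : p ≠ ⊤) (f : ι → ℝ) :
    ellNorm p f ^ p.toReal = ∑' x, ‖f x‖ₑ ^ p.toReal := by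
  let _ : MeasurableSpace ι := ⊤
  have hq : p.toReal ≠ 0 := (ENNReal.toReal_pos hp hp').ne'
  rw [ellNorm, MeasureTheory.eLpNorm_eq_lintegral_rpow_enorm_toReal hp hp',
    MeasureTheory.lintegral_count, one_div, ENNReal.rpow_inv_rpow hq]

lemma ellNorm_top (f : ι → ℝ) : ellNorm ⊤ f = ⨆ x, ‖f x‖ₑ := by
  let _ : MeasurableSpace ι := ⊤
  rw [ellNorm, MeasureTheory.eLpNorm_exponent_top, MeasureTheory.eLpNormEssSup]
  refine le_antisymm (essSup_le_of_ae_le _ (.of_forall fun x => le_iSup (fun x => ‖f x‖ₑ) x)) ?_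
  have h : ∀ᵐ x ∂MeasureTheory.Measure.count, ‖f x‖ₑ ≤
      essSup (fun x => ‖f x‖ₑ) MeasureTheory.Measure.count := ae_le_essSup
  rw [MeasureTheory.ae_iff,
    MeasureTheory.Measure.count_eq_zero_iff] at h
  refine iSup_le fun x => ?_
  by_contra hx
  exact (Set.eq_empty_iff_forall_notMem.1 h) x hx

lemma ellNorm_comp_le (hp : p ≠ 0) {e : κ → ι} (he : Function.Injective e) (f : ι → ℝ) :
    ellNorm p (fun x => f (e x)) ≤ ellNorm p f := by
  by_cases hp' : p = ⊤
  · subst hp'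
    rw [ellNorm_top, ellNorm_top]
    exact iSup_comp_le (fun x => ‖f x‖ₑ) e
  · rw [← ENNReal.rpow_le_rpow_iff (ENNReal.toReal_pos hp hp'), ellNorm_rpow hp hp',
      ellNorm_rpow hp hp']
    exact ENNReal.tsum_comp_le_tsum_of_injective he fun x => ‖f x‖ₑ ^ p.toReal

lemma enorm_le_ellNorm (hp : p ≠ 0) (f : ι → ℝ) (x : ι) : ‖f x‖ₑ ≤ ellNorm p f := by
  by_cases hp' : p = ⊤
  · subst hp'
    rw [ellNorm_top]
    exact le_iSup (fun x => ‖f x‖ₑ) x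
  · rw [← ENNReal.rpow_le_rpow_iff (ENNReal.toReal_pos hp hp'), ellNorm_rpow hp hp']
    exact ENNReal.le_tsum x

lemma ellNorm_add_le (hp : 1 ≤ p) (f g : ι → ℝ) :
    ellNorm p (fun x => f x + g x) ≤ ellNorm p f + ellNorm p g := by
  let _ : MeasurableSpace ι := ⊤
  exact MeasureTheory.eLpNorm_add_le (measurable_from_top.aestronglyMeasurable)
    (measurable_from_top.aestronglyMeasurable) hp

@[simp]
lemma ellNorm_zero : ellNorm p (fun _ : ι => (0 : ℝ)) = 0 := by
  let _ : MeasurableSpace ι := ⊤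
  exact MeasureTheory.eLpNorm_zero

lemma ellNorm_sub_comm (f g : ι → ℝ) :
    ellNorm p (fun x => f x - g x) = ellNorm p (fun x => g x - f x) := by
  let _ : MeasurableSpace ι := ⊤
  exact MeasureTheory.eLpNorm_sub_comm f g p _

lemma tsum_enorm_rpow_ne_top {f : ι → ℝ} (hf : (Function.support f).Finite) {q : ℝ}
    (hq : 0 < q) : ∑' x, ‖f x‖ₑ ^ q ≠ ⊤ := by
  rw [tsum_eq_sum (s := hf.toFinset)]
  · exact ENNReal.sum_ne_top.2 fun x _ => ENNReal.rpow_ne_top_of_nonneg hq.le enorm_ne_top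
  · intro x hx
    have : f x = 0 := by simpa using hx
    simp [this, hq]

lemma tsum_ite_mem_const [DecidableEq ι] (s : Finset ι) (c : ℝ≥0∞) :
    ∑' x, (if x ∈ s then c else 0) = s.card * c := by
  rw [tsum_eq_sum (s := s) (fun x hx => if_neg hx)]
  simp

end EllNorm

lemma encard_preimage_le {α β : Type*} {g : α → β} {m : ℕ}
    (hg : ∀ y, (g ⁻¹' {y}).encard ≤ m) {s : Set β} {n : ℕ} (hs : s.encard ≤ n) :
    (g ⁻¹' s).encard ≤ (m * n : ℕ) := by
  have hfin : s.Finite := Set.finite_of_encard_le_coe hs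
  have key : (g ⁻¹' s).encard ≤ m * s.encard := by
    clear hs
    induction s, hfin using Set.Finite.induction_on with
    | empty => simp
    | @insert a s ha _ ih =>
      rw [Set.encard_insert_of_notMem ha, Set.insert_eq, Set.preimage_union]
      refine (Set.encard_union_le _ _).trans ?_
      rw [mul_add, mul_one, add_comm]
      exact add_le_add ih (hg a)
  refine key.trans ?_
  push_cast
  gcongr

/-! ### Translates, gradients and the profile of one group -/

section Gradient

variable {G : Type*} [Group G] {S : Finset G} {p : ℝ≥0∞}

lemma ellNorm_translate_sub_le (hp : p ≠ 0) (f : G → ℝ) {s : G} (hs : s ∈ S) (g : G) :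
    ellNorm p (fun x => f (s * (g * x)) - f (g * x)) ≤ ellNorm p (leftGradient S f) := by
  refine ellNorm_comp_le (e := fun x => ((⟨s, hs⟩ : S), g * x)) hp ?_ (leftGradient S f)
  intro x y h
  simpa using h

lemma ellNorm_sub_le_of_adj (hp : p ≠ 0) (f : G → ℝ) {g h : G}
    (hgh : (SimpleGraph.mulCayley (S : Set G)).Adj g h) :
    ellNorm p (fun x => f (g⁻¹ * x) - f (h⁻¹ * x)) ≤ ellNorm p (leftGradient S f) := by
  obtain ⟨-, hs | hs⟩ := (SimpleGraph.mulCayley_adj _ g h).1 hgh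
  · simpa [mul_assoc] using ellNorm_translate_sub_le hp f (Finset.mem_coe.1 hs) h⁻¹
  · rw [ellNorm_sub_comm]
    simpa [mul_assoc] using ellNorm_translate_sub_le hp f (Finset.mem_coe.1 hs) g⁻¹

/-- Telescoping along the walk: each edge costs at most one gradient norm. -/
lemma ellNorm_sub_le_of_walk (hp : 1 ≤ p) (f : G → ℝ) {g h : G}
    (w : (SimpleGraph.mulCayley (S : Set G)).Walk g h) :
    ellNorm p (fun x => f (g⁻¹ * x) - f (h⁻¹ * x)) ≤
      w.length * ellNorm p (leftGradient S f) := by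
  have hp0 : p ≠ 0 := (zero_lt_one.trans_le hp).ne'
  induction w with
  | nil => simp
  | @cons u v w hadj _ ih =>
    have h := ellNorm_add_le hp (fun x => f (u⁻¹ * x) - f (v⁻¹ * x))
      (fun x => f (v⁻¹ * x) - f (w⁻¹ * x))
    simp only [sub_add_sub_cancel] at h
    refine h.trans ?_
    rw [SimpleGraph.Walk.length_cons, Nat.cast_add, add_mul, Nat.cast_one, one_mul, add_comm]
    exact add_le_add ih (ellNorm_sub_le_of_adj hp0 f hadj)

lemma ellNorm_sub_le_of_wordDist_le (hp : 1 ≤ p) (f : G → ℝ) {g h : G} {L : ℕ}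
    (hL : wordDist S g h ≤ L) :
    ellNorm p (fun x => f (g⁻¹ * x) - f (h⁻¹ * x)) ≤ L * ellNorm p (leftGradient S f) := by
  obtain ⟨w, hw⟩ := SimpleGraph.exists_walk_of_edist_ne_top
    (ne_top_of_le_ne_top (ENat.natCast_ne_top L) hL)
  refine (ellNorm_sub_le_of_walk hp f w).trans ?_
  have : w.length ≤ L := by
    have h' : (w.length : ℕ∞) ≤ L := hw.trans_le hL
    exact_mod_cast h'
  gcongr

lemma wordDist_inv_le_one {s : G} (hs : s ∈ S) (g : G) : wordDist S g⁻¹ (s * g)⁻¹ ≤ 1 := by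
  rw [wordDist, SimpleGraph.edist_le_one_iff_adj_or_eq, SimpleGraph.mulCayley_adj]
  by_cases h : g⁻¹ = (s * g)⁻¹
  · exact .inr h
  · refine .inl ⟨h, .inr ?_⟩
    simpa using hs

lemma eq_of_leftGradient_eq_zero (hS : IsGenerating S) {f : G → ℝ}
    (hf : ∀ x, leftGradient S f x = 0) (g x : G) : f (g * x) = f x := by
  have hg : g ∈ Subgroup.closure (S : Set G) := by rw [hS]; trivial
  induction hg using Subgroup.closure_induction generalizing x with
  | mem s hs => exact sub_eq_zero.1 (hf (⟨s, hs⟩, x))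
  | one => simp
  | mul a b _ _ ha hb => rw [mul_assoc, ha, hb]
  | inv a _ ha => rw [← ha (a⁻¹ * x), mul_inv_cancel_left]

/-- The isoperimetric inequality encoded by the profile, for functions with finite gradient. -/
lemma ellNorm_le_isoProfile_mul {n : ℕ} (hJ : isoProfile p S n ≠ ⊤) {f : G → ℝ}
    (hf : (Function.support f).encard ≤ n) (hgrad : ellNorm p (leftGradient S f) ≠ ⊤) :
    ellNorm p f ≤ isoProfile p S n * ellNorm p (leftGradient S f) := by
  rw [← ENNReal.div_le_iff_le_mul (.inr hJ) (.inl hgrad)]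
  exact le_iSup₂ (f := fun (f : G → ℝ) (_ : (Function.support f).encard ≤ n) =>
    ellNorm p f / ellNorm p (leftGradient S f)) f hf

/-- The constant function 1 is admissible and has zero gradient. -/
lemma isoProfile_eq_top_of_encard_le (hp : p ≠ 0) {n : ℕ}
    (hn : (Set.univ : Set G).encard ≤ n) : isoProfile p S n = ⊤ := by
  by_contra hJ
  have hgrad : leftGradient S (fun _ : G => (1 : ℝ)) = fun _ => 0 := by
    ext x; simp [leftGradient]
  have h := ellNorm_le_isoProfile_mul (p := p) (S := S) hJ (f := fun _ => 1)
    ((Set.encard_le_encard (Set.subset_univ _)).trans hn) (by simp [hgrad])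
  have h1 := (enorm_le_ellNorm hp (fun _ : G => (1 : ℝ)) 1).trans h
  simp [hgrad] at h1

end Gradient

/-! ### Pulling functions back along a regular map -/

section Pullback

variable {G H : Type*} [Group G] [Group H] {S : Finset G} {T : Finset H} {φ : G → H} {p : ℝ≥0∞}

lemma ellNorm_pullback_sub_le (hp : 1 ≤ p) {L : ℕ}
    (hL : ∀ a b : G, wordDist T (φ a) (φ b) ≤ (L : ℕ∞) * wordDist S a b)
    (f : H → ℝ) {s : G} (hs : s ∈ S) (g : G) :
    ellNorm p (fun y => f ((φ (s * g)⁻¹)⁻¹ * y) - f ((φ g⁻¹)⁻¹ * y)) ≤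
      L * ellNorm p (leftGradient T f) := by
  rw [ellNorm_sub_comm]
  refine ellNorm_sub_le_of_wordDist_le hp f ((hL _ _).trans ?_)
  calc (L : ℕ∞) * wordDist S g⁻¹ (s * g)⁻¹ ≤ L * 1 := by gcongr; exact wordDist_inv_le_one hs g
    _ = L := mul_one _

/-- The fibre over `z` is the inverse of the `φ`-fibre over `y * z⁻¹`. -/
lemma encard_pullback_preimage_le {m : ℕ} (hm : ∀ y : H, (φ ⁻¹' {y}).encard ≤ m) (y : H)
    {s : Set H} {n : ℕ} (hs : s.encard ≤ n) :
    ((fun g : G => (φ g⁻¹)⁻¹ * y) ⁻¹' s).encard ≤ (m * n : ℕ) := by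
  refine encard_preimage_le (fun z => ?_) hs
  have h : (fun g : G => (φ g⁻¹)⁻¹ * y) ⁻¹' {z} = (Equiv.inv G) ⁻¹' (φ ⁻¹' {y * z⁻¹}) := by
    ext g
    simp only [Set.mem_preimage, Set.mem_singleton_iff, Equiv.inv_apply]
    constructor
    · rintro rfl; simp
    · intro h; simp [h]
  rw [h, Set.encard_preimage_of_bijective (Equiv.inv G).bijective]
  exact hm _

lemma ellNorm_top_le_of_regular {L m n : ℕ}
    (hL : ∀ a b : G, wordDist T (φ a) (φ b) ≤ (L : ℕ∞) * wordDist S a b)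
    (hm : ∀ y : H, (φ ⁻¹' {y}).encard ≤ m) {f : H → ℝ}
    (hf : (Function.support f).encard ≤ n) (hD : ellNorm ⊤ (leftGradient T f) ≠ ⊤)
    (hJ : isoProfile ⊤ S (m * n) ≠ ⊤) :
    ellNorm ⊤ f ≤ L * isoProfile ⊤ S (m * n) * ellNorm ⊤ (leftGradient T f) := by
  rw [ellNorm_top]
  refine iSup_le fun x => ?_
  -- This choice makes `u 1 = f x`.
  let y : H := φ 1⁻¹ * x
  let u : G → ℝ := fun g => f ((φ g⁻¹)⁻¹ * y)
  have hu : ellNorm ⊤ (leftGradient S u) ≤ L * ellNorm ⊤ (leftGradient T f) := by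
    rw [ellNorm_top]
    refine iSup_le fun z => ?_
    exact (enorm_le_ellNorm (p := ⊤) (by simp)
      (fun y => f ((φ ((z.1 : G) * z.2)⁻¹)⁻¹ * y) - f ((φ z.2⁻¹)⁻¹ * y)) y).trans
      (ellNorm_pullback_sub_le le_top hL f z.1.2 z.2)
  have hfin := ne_top_of_le_ne_top (ENNReal.mul_ne_top (ENNReal.natCast_ne_top L) hD) hu
  calc ‖f x‖ₑ = ‖u 1‖ₑ := by simp [u, y]
    _ ≤ ellNorm ⊤ u := enorm_le_ellNorm (by simp) u 1
    _ ≤ isoProfile ⊤ S (m * n) * ellNorm ⊤ (leftGradient S u) :=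
      ellNorm_le_isoProfile_mul hJ (encard_pullback_preimage_le hm y hf) hfin
    _ ≤ isoProfile ⊤ S (m * n) * (L * ellNorm ⊤ (leftGradient T f)) := by gcongr
    _ = _ := by ring

/-- The pull-back of a translate of `f` along `g ↦ (φ g⁻¹)⁻¹`, cut off outside `F`. -/
noncomputable def truncatedPullback (φ : G → H) (F : Finset G) (f : H → ℝ) (y : H) : G → ℝ :=
  (F : Set G).indicator fun g => f ((φ g⁻¹)⁻¹ * y)

/-- For fixed `g ∈ F`, `y` runs through `H` and so does `(φ g⁻¹)⁻¹ * y`; each such `g` contributes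
the full sum of `f`. -/
lemma tsum_enorm_truncatedPullback {q : ℝ} (hq : 0 < q) (F : Finset G) (f : H → ℝ) :
    ∑' y, ∑' g, ‖truncatedPullback φ F f y g‖ₑ ^ q = F.card * ∑' x, ‖f x‖ₑ ^ q := by
  classical
  rw [ENNReal.tsum_comm, ← tsum_ite_mem_const]
  refine tsum_congr fun g => ?_
  split_ifs with hg
  · simp only [truncatedPullback, Set.indicator_of_mem (Finset.mem_coe.2 hg)]
    exact (Equiv.mulLeft (φ g⁻¹)⁻¹).tsum_eq fun x => ‖f x‖ₑ ^ q
  · simp [truncatedPullback, hg, hq]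

-- If `g` and `s * g` both lie in `F`, the Lipschitz bound applies. If exactly one does, `g` is in
-- the boundary `(s⁻¹ • F) ∆ F` and one translate of `f` survives.
open scoped Classical in
lemma tsum_enorm_gradient_truncatedPullback_le (hp : 1 ≤ p) (hp' : p ≠ ⊤) {L : ℕ}
    (hL : ∀ a b : G, wordDist T (φ a) (φ b) ≤ (L : ℕ∞) * wordDist S a b)
    (F : Finset G) (f : H → ℝ) {s : G} (hs : s ∈ S) (g : G) :
    ∑' y, ‖truncatedPullback φ F f y (s * g) - truncatedPullback φ F f y g‖ₑ ^ p.toReal ≤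
      (if g ∈ F then (L * ellNorm p (leftGradient T f)) ^ p.toReal else 0) +
      (if g ∈ (s⁻¹ • F) ∆ F then ellNorm p f ^ p.toReal else 0) := by
  have hp0 : p ≠ 0 := (zero_lt_one.trans_le hp).ne'
  have hq : 0 < p.toReal := ENNReal.toReal_pos hp0 hp'
  have hmem : g ∈ s⁻¹ • F ↔ s * g ∈ F := by
    rw [Finset.mem_inv_smul_finset_iff, smul_eq_mul]
  have htrans : ∀ h : H, ∑' y, ‖f (h * y)‖ₑ ^ p.toReal = ellNorm p f ^ p.toReal := fun h => by
    rw [ellNorm_rpow hp0 hp']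
    exact (Equiv.mulLeft h).tsum_eq fun x => ‖f x‖ₑ ^ p.toReal
  by_cases hg : g ∈ F <;> by_cases hsg : s * g ∈ F
  · simp only [truncatedPullback, Set.indicator_of_mem (Finset.mem_coe.2 hg),
      Set.indicator_of_mem (Finset.mem_coe.2 hsg), if_pos hg]
    refine le_add_right ?_
    rw [← ellNorm_rpow hp0 hp' (fun y => f ((φ (s * g)⁻¹)⁻¹ * y) - f ((φ g⁻¹)⁻¹ * y))]
    gcongr
    exact ellNorm_pullback_sub_le hp hL f hs g
  · have h : g ∈ (s⁻¹ • F) ∆ F := Finset.mem_symmDiff.2 (.inr ⟨hg, hmem.not.2 hsg⟩)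
    rw [if_pos h]
    refine le_add_left ?_
    simp [truncatedPullback, hg, hsg, htrans]
  · have h : g ∈ (s⁻¹ • F) ∆ F := Finset.mem_symmDiff.2 (.inl ⟨hmem.2 hsg, hg⟩)
    rw [if_pos h]
    refine le_add_left ?_
    simp [truncatedPullback, hg, hsg, htrans]
  · simp [truncatedPullback, hg, hsg, hq]

/-- Summing the gradients of all truncated pull-backs over an almost invariant set. -/
lemma tsum_gradient_truncatedPullback_le (hp : 1 ≤ p) (hp' : p ≠ ⊤) {L : ℕ}
    (hL : ∀ a b : G, wordDist T (φ a) (φ b) ≤ (L : ℕ∞) * wordDist S a b)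
    {F : Finset G} {f : H → ℝ} {ε : ℝ} (hε : 0 ≤ ε)
    (hF : ∀ s ∈ S, (((s⁻¹ • (F : Set G)) ∆ (F : Set G)).ncard : ℝ) ≤ ε * F.card)
    (hεD : ENNReal.ofReal ε * ellNorm p f ^ p.toReal ≤ ellNorm p (leftGradient T f) ^ p.toReal) :
    ∑' y, ellNorm p (leftGradient S (truncatedPullback φ F f y)) ^ p.toReal ≤
      F.card * (S.card * ((L : ℝ≥0∞) ^ p.toReal + 1) *
        ellNorm p (leftGradient T f) ^ p.toReal) := by
  classical
  have hp0 : p ≠ 0 := (zero_lt_one.trans_le hp).ne'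
  simp only [ellNorm_rpow hp0 hp' (leftGradient S _), leftGradient]
  rw [ENNReal.tsum_comm, ENNReal.tsum_prod', tsum_fintype]
  have key : ∀ s : S, ∑' g, ∑' y, ‖truncatedPullback φ F f y ((s : G) * g) -
      truncatedPullback φ F f y g‖ₑ ^ p.toReal ≤
      F.card * (((L : ℝ≥0∞) ^ p.toReal + 1) * ellNorm p (leftGradient T f) ^ p.toReal) := by
    intro s
    refine (ENNReal.tsum_le_tsum fun g =>
      tsum_enorm_gradient_truncatedPullback_le hp hp' hL F f s.2 g).trans ?_
    rw [ENNReal.tsum_add, tsum_ite_mem_const, tsum_ite_mem_const,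
      ENNReal.mul_rpow_of_nonneg _ _ ENNReal.toReal_nonneg, add_mul, mul_add, one_mul]
    refine add_le_add le_rfl ?_
    have hcard : ((((s : G)⁻¹ • F) ∆ F).card : ℝ≥0∞) ≤ ENNReal.ofReal ε * F.card := by
      have h := hF s s.2
      rw [← Finset.coe_smul_finset, ← Finset.coe_symmDiff, Set.ncard_coe_finset] at h
      rw [← ENNReal.ofReal_natCast, ← ENNReal.ofReal_natCast F.card, ← ENNReal.ofReal_mul hε]
      exact ENNReal.ofReal_le_ofReal h
    calc _ ≤ ENNReal.ofReal ε * F.card * ellNorm p f ^ p.toReal := by gcongr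
      _ = F.card * (ENNReal.ofReal ε * ellNorm p f ^ p.toReal) := by ring
      _ ≤ _ := by gcongr
  refine (Finset.sum_le_sum fun s _ => key s).trans (le_of_eq ?_)
  rw [Finset.sum_const, Finset.card_univ, Fintype.card_coe, nsmul_eq_mul]
  ring

lemma ellNorm_rpow_le_of_regular (hp : 1 ≤ p) (hp' : p ≠ ⊤) (hG : IsAmenable G) {L m n : ℕ}
    (hL : ∀ a b : G, wordDist T (φ a) (φ b) ≤ (L : ℕ∞) * wordDist S a b)
    (hm : ∀ y : H, (φ ⁻¹' {y}).encard ≤ m) {f : H → ℝ}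
    (hf : (Function.support f).encard ≤ n)
    (hD0 : ellNorm p (leftGradient T f) ≠ 0) (hD : ellNorm p (leftGradient T f) ≠ ⊤)
    (hJ : isoProfile p S (m * n) ≠ ⊤) :
    ellNorm p f ^ p.toReal ≤ isoProfile p S (m * n) ^ p.toReal *
      (S.card * ((L : ℝ≥0∞) ^ p.toReal + 1) * ellNorm p (leftGradient T f) ^ p.toReal) := by
  classical
  have hp0 : p ≠ 0 := (zero_lt_one.trans_le hp).ne'
  have hq : 0 < p.toReal := ENNReal.toReal_pos hp0 hp'
  have hE : ellNorm p f ^ p.toReal ≠ ⊤ := by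
    rw [ellNorm_rpow hp0 hp']
    exact tsum_enorm_rpow_ne_top (Set.finite_of_encard_le_coe hf) hq
  have hDq0 : ellNorm p (leftGradient T f) ^ p.toReal ≠ 0 := by simp [hD0, hD]
  have hDq : ellNorm p (leftGradient T f) ^ p.toReal ≠ ⊤ :=
    ENNReal.rpow_ne_top_of_nonneg hq.le hD
  -- Unless `f` has norm zero, the tolerance is `‖∇f‖^p / ‖f‖^p`, so that the boundary terms for
  -- each generator total at most `|F| ‖∇f‖^p`. Thus `F` depends on `f`, but the final constant does
  -- not.
  obtain ⟨ε, hε, hεD⟩ : ∃ ε : ℝ, 0 < ε ∧ ENNReal.ofReal ε * ellNorm p f ^ p.toReal ≤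
      ellNorm p (leftGradient T f) ^ p.toReal := by
    by_cases hE0 : ellNorm p f ^ p.toReal = 0
    · exact ⟨1, one_pos, by simp [hE0]⟩
    · have hne : ellNorm p (leftGradient T f) ^ p.toReal / ellNorm p f ^ p.toReal ≠ ⊤ :=
        ENNReal.div_ne_top hDq hE0
      refine ⟨_, ENNReal.toReal_pos (ENNReal.div_ne_zero.2 ⟨hDq0, hE⟩) hne, ?_⟩
      rw [ENNReal.ofReal_toReal hne, ENNReal.div_mul_cancel hE0 hE]
  obtain ⟨F, hFne, hF⟩ := hG (S.image (·⁻¹)) ε hε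
  have hgrad := tsum_gradient_truncatedPullback_le (S := S) (T := T) (φ := φ) hp hp' hL hε.le
    (fun s hs => hF s⁻¹ (Finset.mem_image_of_mem _ hs)) hεD
  set B := (S.card : ℝ≥0∞) * ((L : ℝ≥0∞) ^ p.toReal + 1) *
    ellNorm p (leftGradient T f) ^ p.toReal with hB
  have hBtop : B ≠ ⊤ := ENNReal.mul_ne_top (ENNReal.mul_ne_top (ENNReal.natCast_ne_top _)
    (ENNReal.add_ne_top.2 ⟨ENNReal.rpow_ne_top_of_nonneg hq.le (ENNReal.natCast_ne_top _),
      ENNReal.one_ne_top⟩)) hDq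
  have hy : ∀ y, ellNorm p (truncatedPullback φ F f y) ^ p.toReal ≤
      isoProfile p S (m * n) ^ p.toReal *
        ellNorm p (leftGradient S (truncatedPullback φ F f y)) ^ p.toReal := by
    intro y
    rw [← ENNReal.mul_rpow_of_nonneg _ _ hq.le]
    refine ENNReal.rpow_le_rpow (ellNorm_le_isoProfile_mul hJ ?_ ?_) hq.le
    · refine (Set.encard_le_encard ?_).trans (encard_pullback_preimage_le hm y hf)
      intro g hg h
      refine hg ?_
      rw [truncatedPullback, Set.indicator_apply_eq_zero]
      exact fun _ => h
    -- Each gradient norm is finite, being a term of a sum with finite bound.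
    · have h := ne_top_of_le_ne_top (ENNReal.mul_ne_top (ENNReal.natCast_ne_top _) hBtop)
        ((ENNReal.le_tsum y).trans hgrad)
      intro htop
      exact h (by rw [htop, ENNReal.top_rpow_of_pos hq])
  have hsum := ENNReal.tsum_le_tsum hy
  rw [ENNReal.tsum_mul_left] at hsum
  simp only [ellNorm_rpow hp0 hp' (truncatedPullback φ F f _)] at hsum
  rw [tsum_enorm_truncatedPullback hq, ← ellNorm_rpow hp0 hp'] at hsum
  have hF0 : (F.card : ℝ≥0∞) ≠ 0 := by simpa using hFne.ne_empty
  rw [← ENNReal.mul_le_mul_iff_right hF0 (ENNReal.natCast_ne_top _)]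
  calc _ ≤ _ := hsum
    _ ≤ isoProfile p S (m * n) ^ p.toReal * (F.card * B) := by gcongr
    _ = _ := by ring

/-- Comparison of the profiles for a single function, with a constant independent of it. -/
lemma exists_ellNorm_div_le_of_regular (hp : 1 ≤ p) (hG : IsAmenable G) (hT : IsGenerating T)
    {L m : ℕ} (hL : ∀ a b : G, wordDist T (φ a) (φ b) ≤ (L : ℕ∞) * wordDist S a b)
    (hm : ∀ y : H, (φ ⁻¹' {y}).encard ≤ m) :
    ∃ M : ℝ≥0, ∀ (n : ℕ) (f : H → ℝ), (Function.support f).encard ≤ n →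
      ellNorm p f / ellNorm p (leftGradient T f) ≤ M * isoProfile p S (m * n) := by
  have hp0 : p ≠ 0 := (zero_lt_one.trans_le hp).ne'
  obtain ⟨M, hM⟩ : ∃ M : ℝ≥0, ∀ (n : ℕ) (f : H → ℝ), (Function.support f).encard ≤ n →
      ellNorm p (leftGradient T f) ≠ 0 → ellNorm p (leftGradient T f) ≠ ⊤ →
      isoProfile p S (m * n) ≠ ⊤ →
      ellNorm p f ≤ M * isoProfile p S (m * n) * ellNorm p (leftGradient T f) := by
    by_cases hp' : p = ⊤
    · subst hp'
      exact ⟨L, fun n f hf _ hD hJ => by simpa using ellNorm_top_le_of_regular hL hm hf hD hJ⟩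
    · have hq : 0 < p.toReal := ENNReal.toReal_pos hp0 hp'
      refine ⟨(S.card * ((L : ℝ≥0) ^ p.toReal + 1)) ^ (p.toReal)⁻¹,
        fun n f hf hD0 hD hJ => ?_⟩
      rw [← ENNReal.rpow_le_rpow_iff hq]
      refine (ellNorm_rpow_le_of_regular hp hp' hG hL hm hf hD0 hD hJ).trans (le_of_eq ?_)
      rw [ENNReal.mul_rpow_of_nonneg _ _ hq.le, ENNReal.mul_rpow_of_nonneg _ _ hq.le,
        ENNReal.coe_rpow_of_nonneg _ (inv_nonneg.2 hq.le), ENNReal.rpow_inv_rpow hq.ne']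
      push_cast
      rw [ENNReal.coe_rpow_of_nonneg _ hq.le]
      push_cast
      ring
  -- Adding 1 keeps the constant nonzero, so its product with an infinite profile is `⊤`.
  refine ⟨M + 1, fun n f hf => ?_⟩
  by_cases hJ : isoProfile p S (m * n) = ⊤
  · rw [hJ, ENNReal.mul_top (by simp)]
    exact le_top
  by_cases hD : ellNorm p (leftGradient T f) = ⊤
  · simp [hD]
  by_cases hD0 : ellNorm p (leftGradient T f) = 0
  -- With zero gradient `f` is constant. If it is nonzero, `H` has at most `n` elements, hence `G`
  -- at most `m * n`, and the profile of `G` is infinite.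
  · have hgrad : ∀ x, leftGradient T f x = 0 := fun x => by
      simpa [hD0] using enorm_le_ellNorm hp0 (leftGradient T f) x
    have hconst : ∀ x, f x = f 1 := fun x => by
      simpa using eq_of_leftGradient_eq_zero hT hgrad x 1
    by_cases h1 : f 1 = 0
    · have : f = fun _ => 0 := funext fun x => (hconst x).trans h1
      simp [this]
    · have hsupp : Function.support f = Set.univ :=
        Set.eq_univ_of_forall fun x => by simpa [hconst x] using h1
      rw [hsupp] at hf
      exact absurd (isoProfile_eq_top_of_encard_le hp0 (encard_preimage_le hm hf)) hJ
  · refine ENNReal.div_le_of_le_mul ((hM n f hf hD0 hD hJ).trans ?_)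
    gcongr
    exact le_self_add

end Pullback

theorem mainTheorem3 {Γ Λ : Type*} [Group Γ] [Group Λ]
    (SΓ : Finset Γ) (SΛ : Finset Λ) (hSΓ : IsGenerating SΓ) (hSΛ : IsGenerating SΛ)
    (hΓ : IsAmenable Γ) (hΛ : IsAmenable Λ)
    (hreg : ∃ φ : Γ → Λ, IsRegularMap SΓ SΛ φ)
    (p : ℝ≥0∞) (hp : 1 ≤ p) :
    AsympLE (isoProfile p SΛ) (isoProfile p SΓ) := by
  obtain ⟨φ, ⟨⟨L, hL⟩, ⟨m, hm⟩⟩⟩ := hreg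
  -- The fibre bound becomes the scaling constant `C`, which must be positive.
  have hm' : ∀ y : Λ, (φ ⁻¹' {y}).encard ≤ (m + 1 : ℕ) := fun y =>
    (hm y).trans (by exact_mod_cast m.le_succ)
  obtain ⟨M, hM⟩ := exists_ellNorm_div_le_of_regular hp hΓ hSΛ hL hm'
  exact ⟨m + 1, m.succ_pos, M, .of_forall fun n => iSup₂_le fun f hf => hM n f hf⟩
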